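/- Let $\mathbb{S}$ be the set of imaginary units of the quaternions $\mathbb{H}$, let $\mathbb{C}_I=\mathbb{R}+I\mathbb{R}$ for $I\in\mathbb{S}$, and for $q_0=x_0+I_0y_0$ let $[q_0]=\{x_0+Jy_0 : J\in\mathbb{S}\}$. A function $f:\mathbb{H}\to\mathbb{H}$ is \emph{entire slice regular} if it is real differentiable and $\frac12(\partial_x+I\partial_y)f(x+Iy)=0$ for all $I\in\mathbb{S}$, $x,y\in\mathbb{R}$; it is \emph{quaternionic intrinsic} if $f(\mathbb{C}_I)\subseteq\mathbb{C}_I$ for every $I\in\mathbb{S}$. Let $\star$ denote the slice regular product. \emph{Order.} With $M_f(r)=\max_{|q|=r}|f(q)|$, the order $\rho\in[0,\infty]$ of $f$ is the greatest lower bound of the numbers $k>0$ such that $M_f(r)<e^{r^k}$ for all sufficiently large $r$ ($\rho=\infty$ if there is no such $k$). \emph{Multiplicities.} Let $f\not\equiv0$ be entire slice regular. The multiplicity of $f$ at a real point $x$ is the largest $r\in\mathbb{N}$ with $f(q)=(q-x)^r g(q)$, $g$ entire slice regular, $g(x)\ne0$. Let $q_0=x_0+I_0y_0$ with $y_0\neq0$.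 The spherical multiplicity of $f$ at $[q_0]$ is the largest $m\in\mathbb{N}$ with $f(q)=[(q-x_0)^2+y_0^2]^m g(q)$, $g$ entire slice regular and not identically zero on $[q_0]$. The isolated multiplicity of $f$ at $q_1\in[q_0]$ is the largest $r\ge1$ such that there are $q_2,\dots,q_r\in[q_0]$ with $q_{\ell+1}\ne\overline{q_\ell}$ for $1\le\ell<r$, an $m\in\mathbb{N}$, and an entire slice regular $g$ without zeros in $[q_0]$ with $f(q)=[(q-x_0)^2+y_0^2]^m\,(q-q_1)\star\cdots\star(q-q_r)\star g(q)$; it is $0$ if there is no such $r$. \emph{Sequence of zeros.} The zeros of $f$ are listed as a (finite or infinite) sequence $\gamma_1,\gamma_2,\dots$ as follows: every real zero is repeated according to its multiplicity; every sphere $[\beta]$ of non-real zeros is listed as a pair $\beta,\overline\beta$, for one chosen representative $\beta$, repeated according to its spherical multiplicity; and every non-real point is listed, in addition, according to its isolated multiplicity. The \emph{convergence exponent} of the sequence is the greatest lower bound in $[0,\infty]$ of the numbers $\lambda>0$ for which $\sum_{\gamma_n\ne0}|\gamma_n|^{-\lambda}$ converges ($\infty$ if there is no such $\lambda$); it depends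 neither on the arrangement of the list nor on the chosen representatives. \textbf{Theorem.} Let $f\not\equiv0$ be an entire slice regular function. (1) If $f$ is quaternionic intrinsic, then the convergence exponent of the sequence of zeros of $f$ does not exceed the order of $f$. (2) If all zeros of $f$ are isolated points of its zero set, then the convergence exponent of the sequence of zeros of $f$ does not exceed the order of $f$. -/

import Mathlib

open Filter Topology
open scoped Quaternion ComplexConjugate

noncomputable section

namespace SliceRegular

/-! ## The quaternionic setting -/

/-- The sphere `𝕊` of imaginary units. -/
def imaginaryUnits : Set ℍ[ℝ] := {I | I.re = 0 ∧ ‖I‖ = 1}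

/-- The complex plane `ℂ_I = {x + I y : x, y ∈ ℝ}`. -/
def complexPlane (I : ℍ[ℝ]) : Set ℍ[ℝ] := {q | ∃ x y : ℝ, q = (x : ℍ[ℝ]) + I * (y : ℍ[ℝ])}

/-- The sphere `[q₀] = {x + J y : J ∈ 𝕊}` of `q₀ = x + I y`; it is the point `q₀` if `q₀` is
real. -/
def axialSphere (q₀ : ℍ[ℝ]) : Set ℍ[ℝ] := {q | q.re = q₀.re ∧ ‖q.im‖ = ‖q₀.im‖}

/-- `f : ℍ → ℍ` is entire (left) slice regular: it is real differentiable and, for every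
imaginary unit `I`, `(1/2) (∂/∂x + I ∂/∂y) f (x + I y) = 0` on the whole plane `ℂ_I`. -/
def IsEntireSliceRegular (f : ℍ[ℝ] → ℍ[ℝ]) : Prop :=
  Differentiable ℝ f ∧
    ∀ I ∈ imaginaryUnits, ∀ x y : ℝ,
      (1 / 2 : ℝ) •
        (deriv (fun s : ℝ => f ((s : ℍ[ℝ]) + I * (y : ℍ[ℝ]))) x +
          I * deriv (fun t : ℝ => f ((x : ℍ[ℝ]) + I * (t : ℍ[ℝ]))) y) = 0

/-- `f` is quaternionic intrinsic: it maps every complex plane `ℂ_I` into itself. -/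
def IsIntrinsic (f : ℍ[ℝ] → ℍ[ℝ]) : Prop :=
  ∀ I ∈ imaginaryUnits, ∀ q ∈ complexPlane I, f q ∈ complexPlane I

/-- Every zero of `f` is an isolated point of the zero set of `f`. -/
def HasOnlyIsolatedZeros (f : ℍ[ℝ] → ℍ[ℝ]) : Prop :=
  ∀ q, f q = 0 → ∀ᶠ p in 𝓝[≠] q, f p ≠ 0

/-! ## The slice regular product

The product of entire slice regular functions is defined by splitting the restrictions to one
complex plane `ℂ_I` as `F + G J` with `J` orthogonal to `I`, and extending the resulting function
from `ℂ_I` to `ℍ`. The product does not depend on `I` and `J`; here `I = i` and `J = j`. -/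

/-- The imaginary unit `i`. -/
def unitI : ℍ[ℝ] := ⟨0, 1, 0, 0⟩

/-- The imaginary unit `j`. -/
def unitJ : ℍ[ℝ] := ⟨0, 0, 1, 0⟩

/-- The component `F` in the splitting `f z = F z + G z * j` for `z ∈ ℂ_i`. -/
def splitF (f : ℍ[ℝ] → ℍ[ℝ]) (z : ℂ) : ℂ := ⟨(f (z : ℍ[ℝ])).re, (f (z : ℍ[ℝ])).imI⟩

/-- The component `G` in the splitting `f z = F z + G z * j` for `z ∈ ℂ_i`. -/
def splitG (f : ℍ[ℝ] → ℍ[ℝ]) (z : ℂ) : ℂ := ⟨(f (z : ℍ[ℝ])).imJ, (f (z : ℍ[ℝ])).imK⟩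

/-- The extension of a function `h` on `ℂ_i` to `ℍ` by the Representation Formula
`ext h (x + I y) = (1/2) (1 - I i) h (x + i y) + (1/2) (1 + I i) h (x - i y)`, where `q = x + I y`
with `y = |Im q|` and `I = Im q / |Im q|`. If `q` is real, then `I` reads `0` and the formula gives
`h q`, as it does for every `I`. -/
def ext (h : ℂ → ℍ[ℝ]) (q : ℍ[ℝ]) : ℍ[ℝ] :=
  (1 / 2 : ℝ) •
    ((1 - (‖q.im‖⁻¹ • q.im) * unitI) * h ⟨q.re, ‖q.im‖⟩ +
      (1 + (‖q.im‖⁻¹ • q.im) * unitI) * h ⟨q.re, -‖q.im‖⟩)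

/-- The slice regular product `f ⋆ g`: if `f = F + G j` and `g = H + K j` on `ℂ_i`, it is the
extension of
`[F(z) H(z) - G(z) conj (K(conj z))] + [F(z) K(z) + G(z) conj (H(conj z))] j`. -/
def starProduct (f g : ℍ[ℝ] → ℍ[ℝ]) : ℍ[ℝ] → ℍ[ℝ] :=
  ext fun z =>
    ((splitF f z * splitF g z - splitG f z * conj (splitG g (conj z)) : ℂ) : ℍ[ℝ]) +
      ((splitF f z * splitG g z + splitG f z * conj (splitF g (conj z)) : ℂ) : ℍ[ℝ]) * unitJ

/-- `(q - p₁) ⋆ (q - p₂) ⋆ ⋯ ⋆ (q - pᵣ) ⋆ g`. -/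
def starLinearFactors (l : List ℍ[ℝ]) (g : ℍ[ℝ] → ℍ[ℝ]) : ℍ[ℝ] → ℍ[ℝ] :=
  l.foldr (fun p h => starProduct (fun q => q - p) h) g

/-! ## Multiplicities of zeros -/

/-- The polynomial `(q - x)² + y²` of the sphere `[q₀]`, `q₀ = x + I y`. Its coefficients are real,
so its `⋆`-product with any function is the pointwise product. -/
def spherePolynomial (q₀ q : ℍ[ℝ]) : ℍ[ℝ] :=
  (q - (q₀.re : ℍ[ℝ])) ^ 2 + ((‖q₀.im‖ ^ 2 : ℝ) : ℍ[ℝ])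

/-- The multiplicity of `f` at a real point `x`: the largest `r` such that `f(q) = (q - x)^r g(q)`
with `g` entire slice regular and `g x ≠ 0`. -/
def realMultiplicity (f : ℍ[ℝ] → ℍ[ℝ]) (x : ℝ) : ℕ∞ :=
  sSup ((fun r : ℕ => (r : ℕ∞)) ''
    {r | ∃ g, IsEntireSliceRegular g ∧ g (x : ℍ[ℝ]) ≠ 0 ∧
      ∀ q, f q = (q - (x : ℍ[ℝ])) ^ r * g q})

/-- The spherical multiplicity of `f` at `[q₀]`, `q₀` not real: the largest `m` such that
`f(q) = ((q - x)² + y²)^m g(q)` with `g` entire slice regular and not identically zero on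
`[q₀]`. -/
def sphericalMultiplicity (f : ℍ[ℝ] → ℍ[ℝ]) (q₀ : ℍ[ℝ]) : ℕ∞ :=
  sSup ((fun m : ℕ => (m : ℕ∞)) ''
    {m | ∃ g, IsEntireSliceRegular g ∧ (∃ p ∈ axialSphere q₀, g p ≠ 0) ∧
      ∀ q, f q = spherePolynomial q₀ q ^ m * g q})

/-- The isolated multiplicity of `f` at a non-real point `q₁`: the largest `r` such that there are
`q₂, …, qᵣ ∈ [q₁]` with `q_{ℓ+1} ≠ conj q_ℓ`, `m ∈ ℕ` and an entire slice regular `g` without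
zeros in `[q₁]` with `f(q) = ((q - x)² + y²)^m (q - q₁) ⋆ (q - q₂) ⋆ ⋯ ⋆ (q - qᵣ) ⋆ g(q)`
(it is `0` if there is no such `r ≥ 1`). -/
def isolatedMultiplicity (f : ℍ[ℝ] → ℍ[ℝ]) (q₁ : ℍ[ℝ]) : ℕ∞ :=
  sSup ((fun r : ℕ => (r : ℕ∞)) ''
    {r | ∃ l : List ℍ[ℝ], (q₁ :: l).length = r ∧ (∀ p ∈ l, p ∈ axialSphere q₁) ∧
      (q₁ :: l).IsChain (fun a b => b ≠ star a) ∧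
      ∃ (m : ℕ) (g : ℍ[ℝ] → ℍ[ℝ]), IsEntireSliceRegular g ∧ (∀ p ∈ axialSphere q₁, g p ≠ 0) ∧
        ∀ q, f q = spherePolynomial q₁ q ^ m * starLinearFactors (q₁ :: l) g q})

/-! ## The sequence of zeros, its convergence exponent, and the order -/

open Classical in
/-- `γ` lists the zeros of `f` with multiplicities: a real zero occurs as often as its multiplicity
says; a spherical zero `[β]` is listed as a pair `β, conj β`, for some representative `β`, repeated
as often as its spherical multiplicity says; and a non-real point occurs, in addition, as often as
its isolated multiplicity says. Any index type is allowed (`ℕ` or `Fin N` for the arrangement as an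
infinite or finite sequence, in any order). -/
structure IsZeroSequence {ι : Type*} (f : ℍ[ℝ] → ℍ[ℝ]) (γ : ι → ℍ[ℝ]) : Prop where
  real : ∀ x : ℝ, {i | γ i = (x : ℍ[ℝ])}.encard = realMultiplicity f x
  nonreal : ∀ q₀ : ℍ[ℝ], q₀.im ≠ 0 → ∃ β ∈ axialSphere q₀, ∀ q ∈ axialSphere q₀,
    {i | γ i = q}.encard =
      (if q = β ∨ q = star β then sphericalMultiplicity f q₀ else 0) + isolatedMultiplicity f q

/-- The convergence exponent of `γ`: the greatest lower bound of the `s > 0` for which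
`∑ 1 / |γ n| ^ s`, over the nonzero `γ n`, converges; it is `⊤` if there is no such `s`. -/
def convergenceExponent {ι : Type*} (γ : ι → ℍ[ℝ]) : EReal :=
  sInf ((fun s : ℝ => (s : EReal)) ''
    {s | 0 < s ∧ Summable fun i : {i // γ i ≠ 0} => 1 / ‖γ i‖ ^ s})

/-- `M_f(r) = max_{|q| = r} |f(q)|`. -/
def maxModulus (f : ℍ[ℝ] → ℍ[ℝ]) (r : ℝ) : ℝ :=
  sSup ((fun q => ‖f q‖) '' Metric.sphere (0 : ℍ[ℝ]) r)

/-- The order of `f`: the greatest lower bound of the `k > 0` such that `M_f(r) < exp (r ^ k)` for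
all sufficiently large `r`; it is `⊤` if there is no such `k`. -/
def order (f : ℍ[ℝ] → ℍ[ℝ]) : EReal :=
  sInf ((fun k : ℝ => (k : EReal)) ''
    {k | 0 < k ∧ ∀ᶠ r : ℝ in atTop, maxModulus f r < Real.exp (r ^ k)})

end SliceRegular

end

/-!
The zeros of a slice regular function `f` are read off from one entire function of a complex
variable, its symmetrization. Splitting `f = F + G j` on `ℂ_i`, put `A z = !![F z, G z; -conj (G
(conj z)), conj (F (conj z))]` (`stemMatrix`). The slice regular product becomes the matrix
product (`stemMatrix_starProduct`), so `h = det A` (`symmetrization`) is multiplicative. It is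
entire and not identically zero, and `|h z| ≤ M_f(|z|) ^ 2` (`norm_symmetrization_le_maxModulus`),
so that it grows no faster than `f`.

A factor `q - p` has symmetrization `(z - x)² + y²`, where `p` has real part `x` and imaginary
part of norm `y`. Hence each multiplicity of `f` on the sphere of `p` is at most the order of
vanishing of `h` at `x + i y` (`realMultiplicity_le`, `sphericalMultiplicity_le`,
`isolatedMultiplicity_le`).

Only three points of a sphere can occur in a zero sequence: the pair `β`, `conj β`, and a single
point of positive isolated multiplicity (`eq_of_isolatedMultiplicity_ne_zero`). The last fact
rests on two observations about the matrices `N p` of `z₀ - p`, `z₀ = x + i y`. First, `N p * N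
(star p) = 0`. Secondly, `N p' - N p` is the matrix of the quaternion `p - p'`, invertible if `p ≠
p'`, so that a matrix annihilated from one side by both `N p` and `N p'` is zero. They show that a
chain of linear factors without consecutive conjugates does not vanish at `z₀`
(`stemMatrix_starLinearFactors_ne_zero`), which determines the power of the spherical factor, and
then that the remaining factor determines `p`.

Thus the number of entries of modulus at most `r` in the zero sequence is at most six times the
number of zeros of `h`, with multiplicity, in the disc of radius `r`, which Jensen's inequality
bounds by `O(r ^ k)` if `M_f(r) < exp (r ^ k)` for large `r` (`IsZeroSequence.exists_card_le`).
Summing over dyadic shells, `∑ 1 / |γ n| ^ s` converges for every `s > k`.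
-/

noncomputable section

namespace SliceRegular

/-! ### Counting zeros and convergence exponents -/

/-- Jensen's inequality as a bound for the number of zeros, with multiplicity, in a finite set. -/
theorem sum_analyticOrderNatAt_le {h : ℂ → ℂ} (hh : Differentiable ℂ h) {c : ℂ} (hc : h c ≠ 0)
    {r M : ℝ} (hr : 0 < r) (hM : 1 ≤ M) (hb : ∀ z ∈ Metric.sphere c (2 * r), ‖h z‖ ≤ M)
    (Z : Finset ℂ) (hZ : ∀ z ∈ Z, z ∈ Metric.closedBall c r) :
    ∑ z ∈ Z, (analyticOrderNatAt h z : ℝ) ≤ Real.log (M / ‖h c‖) / Real.log 2 := by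
  have han : ∀ U, AnalyticOnNhd ℂ h U := fun U z _ => hh.analyticAt z
  have h2r : |2 * r| = 2 * r := abs_of_pos (by linarith)
  have hr' : |r| = r := abs_of_pos hr
  have key := AnalyticOnNhd.sum_divisor_le (c := c) (r := r) (R := 2 * r) (M := M) (f := h)
    (by rwa [hr']) (by rw [hr', h2r]; linarith) hM (han _) hc (by rwa [h2r])
  rw [hr', mul_div_assoc, div_self hr.ne', mul_one] at key
  set D := MeromorphicOn.divisor h (Metric.closedBall c r) with hD
  have hfin : (Function.support D).Finite := D.finiteSupport (isCompact_closedBall ..)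
  have hnn : ∀ z, 0 ≤ D z := fun z => MeromorphicOn.AnalyticOnNhd.divisor_nonneg (han _) z
  refine le_trans ?_ key
  have h1 : ∑ z ∈ Z, (analyticOrderNatAt h z : ℤ) = ∑ z ∈ Z, D z := by
    refine Finset.sum_congr rfl fun z hz => ?_
    rw [hD, MeromorphicOn.AnalyticOnNhd.divisor_apply (han _) (hZ z hz), analyticOrderNatAt]
    cases analyticOrderAt h z <;> simp
  have h2 : ∑ z ∈ Z, D z ≤ ∑ᶠ z, D z := by
    rw [finsum_eq_sum_of_support_subset D (s := hfin.toFinset ∪ Z) (by simp)]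
    exact Finset.sum_le_sum_of_subset_of_nonneg Finset.subset_union_right fun z _ _ => hnn z
  exact_mod_cast h1.trans_le h2

/-- A family whose counting function is `O(r ^ k)` has convergence exponent at most `k`: a dyadic
shell `2 ^ n ≤ a i < 2 ^ (n + 1)` contributes at most a constant times `2 ^ (n * (k - s))`. -/
theorem summable_one_div_rpow_of_card_le {ι : Type*} {a : ι → ℝ} {k s C r₀ : ℝ}
    (hk : 0 < k) (hks : k < s)
    (hcount : ∀ r, r₀ ≤ r → ∀ T : Finset ι, (∀ i ∈ T, a i ≤ r) → (T.card : ℝ) ≤ C * r ^ k) :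
    Summable fun i => 1 / a i ^ s := by
  obtain ⟨N, hN⟩ : ∃ N : ℕ, r₀ ≤ 2 ^ N := by
    obtain ⟨N, hN⟩ := pow_unbounded_of_one_lt r₀ (one_lt_two)
    exact ⟨N, hN.le⟩
  have hN1 : (1 : ℝ) ≤ 2 ^ N := one_le_pow₀ one_le_two
  have hC : 0 ≤ C := by
    have := hcount (2 ^ N) hN ∅ (by simp)
    have h3 : (0 : ℝ) < (2 ^ N : ℝ) ^ k := by positivity
    simp only [Finset.card_empty, Nat.cast_zero] at this
    nlinarith
  have hsmall : {i | a i < 2 ^ N}.Finite := by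
    by_contra hinf
    obtain ⟨m, hm⟩ := exists_nat_gt (C * (2 ^ N : ℝ) ^ k)
    obtain ⟨T, hT, hTm⟩ := Set.Infinite.exists_subset_card_eq hinf m
    have := hcount (2 ^ N) hN T fun i hi => le_of_lt (hT hi)
    rw [hTm] at this
    linarith
  rw [← hsmall.summable_compl_iff]
  set q : ℝ := (2 : ℝ) ^ (k - s) with hq
  have hq0 : 0 ≤ q := by positivity
  have hq1 : q < 1 := Real.rpow_lt_one_of_one_lt_of_neg one_lt_two (by linarith)
  have hgeo : Summable fun n : ℕ => C * 2 ^ k * q ^ n :=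
    (summable_geometric_of_lt_one hq0 hq1).mul_left _
  have hlarge : ∀ i : ↥({i | a i < 2 ^ N}ᶜ : Set ι), (2 : ℝ) ^ N ≤ a i := fun i => not_lt.mp i.2
  refine summable_of_sum_le (c := ∑' n : ℕ, C * 2 ^ k * q ^ n) (fun i => ?_) fun T => ?_
  · have := (zero_lt_one.trans_le hN1).trans_le (hlarge i)
    simp only [Function.comp_apply, Pi.zero_apply]
    positivity
  let lev : ↥({i | a i < 2 ^ N}ᶜ : Set ι) → ℕ := fun i => Nat.log 2 ⌊a i⌋₊
  have hlev : ∀ i, (2 : ℝ) ^ lev i ≤ a i ∧ a i ≤ 2 ^ (lev i + 1) ∧ N ≤ lev i := by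
    intro i
    have h1 := hlarge i
    have h0 : 0 ≤ a i := (zero_le_one.trans hN1).trans h1
    have h2 : 2 ^ N ≤ ⌊a i⌋₊ := Nat.le_floor (by exact_mod_cast h1)
    have h3 : ⌊a i⌋₊ ≠ 0 := (Nat.pos_of_ne_zero (by positivity) |>.trans_le h2).ne'
    refine ⟨?_, ?_, ?_⟩
    · refine le_trans ?_ (Nat.floor_le h0)
      exact_mod_cast Nat.pow_log_le_self 2 h3
    · refine (Nat.lt_floor_add_one (a i)).le.trans ?_
      exact_mod_cast Nat.lt_pow_succ_log_self one_lt_two ⌊a i⌋₊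
    · exact Nat.le_log_of_pow_le one_lt_two h2
  rw [← Finset.sum_fiberwise_of_maps_to (s := T) (t := T.image lev) (g := lev)
    fun i hi => Finset.mem_image_of_mem _ hi]
  refine le_trans (Finset.sum_le_sum fun n hn => ?_)
    (hgeo.sum_le_tsum (T.image lev) fun n _ => by positivity)
  obtain ⟨i₀, -, rfl⟩ := Finset.mem_image.mp hn
  set n := lev i₀ with hn'
  have hterm : ∀ i ∈ T.filter (fun i => lev i = n),
      ((fun i => 1 / a i ^ s) ∘ (fun i : ↥({i | a i < 2 ^ N}ᶜ : Set ι) => (i : ι))) i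
        ≤ 1 / ((2 : ℝ) ^ n) ^ s := by
    intro i hi
    rw [Finset.mem_filter] at hi
    have := (hlev i).1
    rw [hi.2] at this
    simp only [Function.comp_apply]
    have hs : 0 ≤ s := by linarith
    gcongr
  refine (Finset.sum_le_card_nsmul _ _ _ hterm).trans ?_
  have hcard : ((T.filter (fun i => lev i = n)).card : ℝ) ≤ C * ((2 : ℝ) ^ (n + 1)) ^ k := by
    have := hcount (2 ^ (n + 1)) (hN.trans (pow_le_pow_right₀ one_le_two (by
      have := (hlev i₀).2.2; omega))) ((T.filter (fun i => lev i = n)).map ⟨Subtype.val,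
      Subtype.val_injective⟩) (by
        intro i hi
        simp only [Finset.mem_map, Finset.mem_filter, Function.Embedding.coeFn_mk] at hi
        obtain ⟨j, ⟨-, hj⟩, rfl⟩ := hi
        have := (hlev j).2.1
        rwa [hj] at this)
    rwa [Finset.card_map] at this
  rw [nsmul_eq_mul]
  refine (mul_le_mul_of_nonneg_right hcard (by positivity)).trans (le_of_eq ?_)
  rw [hq, Real.rpow_sub two_pos, div_pow, pow_succ,
    Real.mul_rpow (by positivity) (by positivity), ← Real.rpow_natCast, ← Real.rpow_natCast,
    ← Real.rpow_natCast, ← Real.rpow_mul two_pos.le, ← Real.rpow_mul two_pos.le,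
    ← Real.rpow_mul two_pos.le, ← Real.rpow_mul two_pos.le, mul_comm (n : ℝ) k,
    mul_comm (n : ℝ) s]
  ring

/-! ### Restrictions to complex planes and the Representation Formula -/

@[simp] theorem re_unitI : unitI.re = 0 := rfl
@[simp] theorem imI_unitI : unitI.imI = 1 := rfl
@[simp] theorem imJ_unitI : unitI.imJ = 0 := rfl
@[simp] theorem imK_unitI : unitI.imK = 0 := rfl
@[simp] theorem re_unitJ : unitJ.re = 0 := rfl
@[simp] theorem imI_unitJ : unitJ.imI = 0 := rfl
@[simp] theorem imJ_unitJ : unitJ.imJ = 1 := rfl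
@[simp] theorem imK_unitJ : unitJ.imK = 0 := rfl

theorem unitI_mem_imaginaryUnits : unitI ∈ imaginaryUnits := by
  refine ⟨rfl, ?_⟩
  rw [← sq_eq_sq₀ (norm_nonneg _) zero_le_one, sq, ← Quaternion.normSq_eq_norm_mul_self,
    Quaternion.normSq_def']
  simp

theorem neg_mem_imaginaryUnits {I : ℍ[ℝ]} (hI : I ∈ imaginaryUnits) : -I ∈ imaginaryUnits := by
  simpa [imaginaryUnits] using hI

theorem mul_self_of_mem_imaginaryUnits {I : ℍ[ℝ]} (hI : I ∈ imaginaryUnits) : I * I = -1 := by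
  obtain ⟨h0, h1⟩ := hI
  have h2 : Quaternion.normSq I = 1 := by rw [Quaternion.normSq_eq_norm_mul_self, h1, one_mul]
  have h3 : star I = -I := Quaternion.star_eq_neg.mpr h0
  have h4 := Quaternion.self_mul_star I
  rw [h3, h2, mul_neg] at h4
  rw [← neg_neg (I * I), h4]
  simp

theorem ofReal_add_unitI_mul (z : ℂ) :
    ((z.re : ℝ) : ℍ[ℝ]) + unitI * ((z.im : ℝ) : ℍ[ℝ]) = (z : ℍ[ℝ]) := by
  ext <;> simp

theorem ofReal_add_neg_unitI_mul (z : ℂ) :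
    ((z.re : ℝ) : ℍ[ℝ]) + -unitI * ((z.im : ℝ) : ℍ[ℝ]) = ((conj z : ℂ) : ℍ[ℝ]) := by
  ext <;> simp

/-- A real linear functional `φ : ℍ → ℂ` that turns left multiplication by `I` into multiplication
by `i` turns the restriction of a slice regular function to `ℂ_I` into an entire function. -/
theorem IsEntireSliceRegular.differentiable_comp {f : ℍ[ℝ] → ℍ[ℝ]} (hf : IsEntireSliceRegular f)
    {I : ℍ[ℝ]} (hI : I ∈ imaginaryUnits) (φ : ℍ[ℝ] →L[ℝ] ℂ)
    (hφ : ∀ q, φ (I * q) = Complex.I * φ q) :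
    Differentiable ℂ fun z : ℂ => φ (f ((z.re : ℍ[ℝ]) + I * (z.im : ℍ[ℝ]))) := by
  let u : ℂ →L[ℝ] ℍ[ℝ] := Complex.reCLM.smulRight 1 + Complex.imCLM.smulRight I
  have hu : ∀ z : ℂ, (z.re : ℍ[ℝ]) + I * (z.im : ℍ[ℝ]) = u z := by
    intro z
    simp only [u, add_apply, ContinuousLinearMap.smulRight_apply,
      Complex.reCLM_apply, Complex.imCLM_apply]
    rw [Quaternion.mul_coe_eq_smul, ← Quaternion.coe_mul_eq_smul z.re, mul_one]
  have hu1 : u 1 = 1 := by simp [u]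
  have huI : u Complex.I = I := by simp [u]
  simp only [hu]
  intro z
  rw [differentiableAt_complex_iff_differentiableAt_real]
  have hfz : HasFDerivAt f (fderiv ℝ f (u z)) (u z) := (hf.1 (u z)).hasFDerivAt
  have hcomp : HasFDerivAt (fun z : ℂ => φ (f (u z))) (φ.comp ((fderiv ℝ f (u z)).comp u)) z :=
    φ.hasFDerivAt.comp z (hfz.comp z u.hasFDerivAt)
  refine ⟨hcomp.differentiableAt, ?_⟩
  rw [hcomp.fderiv]
  simp only [ContinuousLinearMap.comp_apply, hu1, huI, smul_eq_mul]
  have hx : HasDerivAt (fun s : ℝ => f ((s : ℍ[ℝ]) + I * (z.im : ℍ[ℝ]))) (fderiv ℝ f (u z) 1)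
      z.re := by
    have h1 : HasDerivAt (fun s : ℝ => (s : ℍ[ℝ]) + I * (z.im : ℍ[ℝ])) 1 z.re := by
      have := ((hasDerivAt_id z.re).smul_const (1 : ℍ[ℝ])).add_const (I * (z.im : ℍ[ℝ]))
      simpa [← Quaternion.coe_mul_eq_smul] using this
    rw [← hu] at hfz ⊢
    exact hfz.comp_hasDerivAt z.re h1
  have hy : HasDerivAt (fun t : ℝ => f ((z.re : ℍ[ℝ]) + I * (t : ℍ[ℝ]))) (fderiv ℝ f (u z) I)
      z.im := by
    have h1 : HasDerivAt (fun t : ℝ => (z.re : ℍ[ℝ]) + I * (t : ℍ[ℝ])) I z.im := by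
      have := ((hasDerivAt_id z.im).smul_const I).const_add (z.re : ℍ[ℝ])
      simpa [Quaternion.mul_coe_eq_smul] using this
    rw [← hu] at hfz ⊢
    exact hfz.comp_hasDerivAt z.im h1
  have hCR := hf.2 I hI z.re z.im
  rw [hx.deriv, hy.deriv, smul_eq_zero] at hCR
  have hCR := hCR.resolve_left (by norm_num)
  rw [← hφ]
  congr 1
  have h2 := congrArg (fun q => I * q) hCR
  simp only [mul_add, ← mul_assoc, mul_self_of_mem_imaginaryUnits hI, mul_zero] at h2
  rw [neg_one_mul, ← sub_eq_add_neg, sub_eq_zero] at h2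
  exact h2.symm

/-- The functional `q ↦ Re (q c) - i Re (I q c)`. For fixed `I` these functionals separate points,
and they turn left multiplication by `I` into multiplication by `i`. -/
def sliceFunctional (I c : ℍ[ℝ]) : ℍ[ℝ] →L[ℝ] ℂ :=
  LinearMap.toContinuousLinearMap
    { toFun := fun q => ⟨(q * c).re, -(I * (q * c)).re⟩
      map_add' := fun p q => by
        apply Complex.ext
        · simp [add_mul]
        · simp [add_mul, mul_add]; ring
      map_smul' := fun r q => by
        apply Complex.ext
        · simp
        · simp; ring }

theorem sliceFunctional_apply (I c q : ℍ[ℝ]) :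
    sliceFunctional I c q = ⟨(q * c).re, -(I * (q * c)).re⟩ := rfl

theorem sliceFunctional_mul {I : ℍ[ℝ]} (hI : I ∈ imaginaryUnits) (c q : ℍ[ℝ]) :
    sliceFunctional I c (I * q) = Complex.I * sliceFunctional I c q := by
  have h : I * (I * q * c) = -(q * c) := by
    rw [← mul_assoc, ← mul_assoc, mul_self_of_mem_imaginaryUnits hI]; simp
  rw [sliceFunctional_apply, sliceFunctional_apply, h]
  apply Complex.ext <;> simp [mul_assoc]

theorem eq_of_sliceFunctional_eq (I : ℍ[ℝ]) {p q : ℍ[ℝ]}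
    (h : ∀ c, sliceFunctional I c p = sliceFunctional I c q) : p = q := by
  have h1 := congrArg Complex.re (h (star (p - q)))
  simp only [sliceFunctional_apply] at h1
  have h2 : ((p - q) * star (p - q)).re = 0 := by rw [sub_mul, Quaternion.re_sub, h1, sub_self]
  rw [Quaternion.self_mul_star, Quaternion.re_coe, Quaternion.normSq_eq_zero] at h2
  exact sub_eq_zero.mp h2

theorem eq_of_eq_ofReal {g h : ℂ → ℂ} (hg : Differentiable ℂ g) (hh : Differentiable ℂ h)
    (heq : ∀ x : ℝ, g x = h x) : g = h := by
  refine AnalyticOnNhd.eq_of_frequently_eq (z₀ := 0) (fun z _ => hg.analyticAt z)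
    (fun z _ => hh.analyticAt z) ?_
  have h1 : Tendsto (fun x : ℝ => (x : ℂ)) (𝓝[≠] 0) (𝓝[≠] 0) := by
    refine tendsto_nhdsWithin_iff.mpr ⟨?_, ?_⟩
    · have : Tendsto (fun x : ℝ => (x : ℂ)) (𝓝 0) (𝓝 ((0 : ℝ) : ℂ)) :=
        Complex.continuous_ofReal.tendsto 0
      simpa using this.mono_left nhdsWithin_le_nhds
    · filter_upwards [self_mem_nhdsWithin] with x hx
      simpa using hx
  exact h1.frequently (Eventually.frequently (Eventually.of_forall heq))

/-- The Representation Formula: the values on `ℂ_i` determine those on every `ℂ_I`. -/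
theorem IsEntireSliceRegular.representation {f : ℍ[ℝ] → ℍ[ℝ]} (hf : IsEntireSliceRegular f)
    {I : ℍ[ℝ]} (hI : I ∈ imaginaryUnits) (z : ℂ) :
    f ((z.re : ℍ[ℝ]) + I * (z.im : ℍ[ℝ])) =
      (1 / 2 : ℝ) • ((1 - I * unitI) * f (z : ℍ[ℝ]) +
        (1 + I * unitI) * f ((conj z : ℂ) : ℍ[ℝ])) := by
  refine eq_of_sliceFunctional_eq I fun c => ?_
  have hI2 := mul_self_of_mem_imaginaryUnits hI
  have hi2 := mul_self_of_mem_imaginaryUnits unitI_mem_imaginaryUnits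
  set φ := sliceFunctional I c with hφ
  have hφI : ∀ q, φ (I * q) = Complex.I * φ q := sliceFunctional_mul hI c
  have h1 := hf.differentiable_comp unitI_mem_imaginaryUnits
    (φ.comp (ContinuousLinearMap.mul ℝ ℍ[ℝ] (1 - I * unitI))) (by
      intro q
      simp only [ContinuousLinearMap.comp_apply, ContinuousLinearMap.mul_apply']
      rw [← hφI, ← mul_assoc, ← mul_assoc]
      congr 2
      rw [sub_mul, mul_sub, mul_assoc I, hi2, ← mul_assoc I I, hI2]
      noncomm_ring)
  have h2 := hf.differentiable_comp (neg_mem_imaginaryUnits unitI_mem_imaginaryUnits)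
    (φ.comp (ContinuousLinearMap.mul ℝ ℍ[ℝ] (1 + I * unitI))) (by
      intro q
      simp only [ContinuousLinearMap.comp_apply, ContinuousLinearMap.mul_apply']
      rw [← hφI, ← mul_assoc, ← mul_assoc]
      congr 2
      rw [add_mul, mul_add, mul_assoc I, mul_neg unitI unitI, hi2, neg_neg, ← mul_assoc I I, hI2]
      noncomm_ring)
  have h3 := hf.differentiable_comp hI φ hφI
  simp only [ofReal_add_unitI_mul, ofReal_add_neg_unitI_mul, ContinuousLinearMap.comp_apply,
    ContinuousLinearMap.mul_apply'] at h1 h2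
  have h4 := eq_of_eq_ofReal h3 ((h1.add h2).const_mul (1 / 2 : ℂ)) (by
    intro x
    simp only [Complex.ofReal_re, Complex.ofReal_im, Pi.add_apply, Complex.conj_ofReal,
      Quaternion.coeComplex_coe]
    rw [← map_add, ← add_mul]
    have : (1 - I * unitI + (1 + I * unitI)) = (2 : ℝ) • (1 : ℍ[ℝ]) := by
      rw [two_smul]; abel
    rw [this]
    simp)
  have h5 := congrFun h4 z
  simp only [Pi.add_apply] at h5
  rw [h5, map_smul, map_add]
  simp [mul_add]

theorem splitF_apply (f : ℍ[ℝ] → ℍ[ℝ]) (z : ℂ) :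
    splitF f z = ⟨(f (z : ℍ[ℝ])).re, (f (z : ℍ[ℝ])).imI⟩ := rfl

theorem splitG_apply (f : ℍ[ℝ] → ℍ[ℝ]) (z : ℂ) :
    splitG f z = ⟨(f (z : ℍ[ℝ])).imJ, (f (z : ℍ[ℝ])).imK⟩ := rfl

theorem IsEntireSliceRegular.differentiable_splitF {f : ℍ[ℝ] → ℍ[ℝ]}
    (hf : IsEntireSliceRegular f) : Differentiable ℂ (splitF f) := by
  have h := hf.differentiable_comp unitI_mem_imaginaryUnits (LinearMap.toContinuousLinearMap
    { toFun := fun q : ℍ[ℝ] => (⟨q.re, q.imI⟩ : ℂ)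
      map_add' := fun p q => by apply Complex.ext <;> simp
      map_smul' := fun r q => by apply Complex.ext <;> simp })
    (fun q => by apply Complex.ext <;> simp)
  simp only [ofReal_add_unitI_mul] at h
  exact h

theorem IsEntireSliceRegular.differentiable_splitG {f : ℍ[ℝ] → ℍ[ℝ]}
    (hf : IsEntireSliceRegular f) : Differentiable ℂ (splitG f) := by
  have h := hf.differentiable_comp unitI_mem_imaginaryUnits (LinearMap.toContinuousLinearMap
    { toFun := fun q : ℍ[ℝ] => (⟨q.imJ, q.imK⟩ : ℂ)
      map_add' := fun p q => by apply Complex.ext <;> simp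
      map_smul' := fun r q => by apply Complex.ext <;> simp })
    (fun q => by apply Complex.ext <;> simp)
  simp only [ofReal_add_unitI_mul] at h
  exact h

/-! ### Stem matrices and the symmetrization -/

/-- The splitting components of `f` arranged in a complex matrix, so that the slice regular product
becomes the matrix product. -/
def stemMatrix (f : ℍ[ℝ] → ℍ[ℝ]) (z : ℂ) : Matrix (Fin 2) (Fin 2) ℂ :=
  !![splitF f z, splitG f z; -conj (splitG f (conj z)), conj (splitF f (conj z))]

/-- The symmetrization (normal function) of `f`, restricted to `ℂ_i`. -/
def symmetrization (f : ℍ[ℝ] → ℍ[ℝ]) (z : ℂ) : ℂ := (stemMatrix f z).det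

theorem symmetrization_apply (f : ℍ[ℝ] → ℍ[ℝ]) (z : ℂ) : symmetrization f z =
    splitF f z * conj (splitF f (conj z)) + splitG f z * conj (splitG f (conj z)) := by
  rw [symmetrization, stemMatrix, Matrix.det_fin_two_of]; ring

theorem IsEntireSliceRegular.differentiable_symmetrization {f : ℍ[ℝ] → ℍ[ℝ]}
    (hf : IsEntireSliceRegular f) : Differentiable ℂ (symmetrization f) := by
  have hF : Differentiable ℂ fun z => conj (splitF f (conj z)) := fun z =>
    (differentiableAt_conj_conj_iff (f := splitF f)).mpr (hf.differentiable_splitF _)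
  have hG : Differentiable ℂ fun z => conj (splitG f (conj z)) := fun z =>
    (differentiableAt_conj_conj_iff (f := splitG f)).mpr (hf.differentiable_splitG _)
  have h : symmetrization f = fun z => splitF f z * conj (splitF f (conj z)) +
      splitG f z * conj (splitG f (conj z)) := funext (symmetrization_apply f)
  rw [h]
  exact (hf.differentiable_splitF.mul hF).add (hf.differentiable_splitG.mul hG)

theorem IsEntireSliceRegular.continuous_stemMatrix {f : ℍ[ℝ] → ℍ[ℝ]}
    (hf : IsEntireSliceRegular f) : Continuous (stemMatrix f) := by
  have hF := hf.differentiable_splitF.continuous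
  have hG := hf.differentiable_splitG.continuous
  refine continuous_matrix fun i j => ?_
  fin_cases i <;> fin_cases j <;> simp only [stemMatrix]
  · exact hF
  · exact hG
  · exact (Complex.continuous_conj.comp (hG.comp Complex.continuous_conj)).neg
  · exact Complex.continuous_conj.comp (hF.comp Complex.continuous_conj)

/-- The extension of a function `h` on `ℂ_i` restricts to `h`, whatever `h` is. -/
theorem ext_coeComplex (h : ℂ → ℍ[ℝ]) (z : ℂ) : ext h (z : ℍ[ℝ]) = h z := by
  have him : (z : ℍ[ℝ]).im = z.im • unitI := by ext <;> simp
  have hI := unitI_mem_imaginaryUnits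
  have hi2 := mul_self_of_mem_imaginaryUnits hI
  have hn : ‖(z : ℍ[ℝ]).im‖ = |z.im| := by rw [him, norm_smul, hI.2, mul_one, Real.norm_eq_abs]
  have h2 : ∀ q : ℍ[ℝ], (1 / 2 : ℝ) • ((1 + 1) * q) = q := by
    intro q
    rw [add_mul, one_mul, ← two_smul ℝ q, smul_smul]
    norm_num
  rw [ext, hn, him, Quaternion.re_coeComplex]
  rcases lt_trichotomy z.im 0 with hz | hz | hz
  · have h1 : |z.im|⁻¹ • z.im • unitI * unitI = 1 := by
      rw [abs_of_neg hz, smul_smul, inv_neg, neg_mul, inv_mul_cancel₀ hz.ne, neg_smul, one_smul,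
        neg_mul, hi2, neg_neg]
    rw [h1, sub_self, zero_mul, zero_add, h2, abs_of_neg hz, neg_neg]
  · rw [hz]
    have : z = ⟨z.re, 0⟩ := Complex.ext rfl hz
    simp only [abs_zero, zero_smul, smul_zero, zero_mul, sub_zero, add_zero, one_mul, neg_zero]
    rw [← this, ← two_smul ℝ (h z), smul_smul]; norm_num
  · have h1 : |z.im|⁻¹ • z.im • unitI * unitI = -1 := by
      rw [abs_of_pos hz, smul_smul, inv_mul_cancel₀ hz.ne', one_smul, hi2]
    rw [h1, add_neg_cancel, zero_mul, add_zero, sub_neg_eq_add, h2, abs_of_pos hz]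

theorem stemMatrix_starProduct (f g : ℍ[ℝ] → ℍ[ℝ]) (z : ℂ) :
    stemMatrix (starProduct f g) z = stemMatrix f z * stemMatrix g z := by
  have hF : ∀ z, splitF (starProduct f g) z =
      splitF f z * splitF g z - splitG f z * conj (splitG g (conj z)) := by
    intro z
    rw [splitF_apply, starProduct, ext_coeComplex]
    apply Complex.ext <;> simp
  have hG : ∀ z, splitG (starProduct f g) z =
      splitF f z * splitG g z + splitG f z * conj (splitF g (conj z)) := by
    intro z
    rw [splitG_apply, starProduct, ext_coeComplex]
    apply Complex.ext <;> simp
  simp only [stemMatrix, hF, hG, Matrix.mul_fin_two, Complex.conj_conj, map_sub, map_add, map_mul]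
  congr 1
  ring_nf

/-- A slice function whose restriction to `ℂ_i` is `a g`, with `a` intrinsic, has the stem matrix of
`g` scaled by `a`. -/
theorem stemMatrix_of_forall_eq_mul {f g : ℍ[ℝ] → ℍ[ℝ]} {a : ℂ → ℂ}
    (ha : ∀ z, conj (a (conj z)) = a z)
    (hfg : ∀ z : ℂ, f (z : ℍ[ℝ]) = ((a z : ℂ) : ℍ[ℝ]) * g (z : ℍ[ℝ])) (z : ℂ) :
    stemMatrix f z = a z • stemMatrix g z := by
  have hF : ∀ z, splitF f z = a z * splitF g z := by
    intro z
    rw [splitF_apply, splitF_apply, hfg]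
    apply Complex.ext <;> simp
  have hG : ∀ z, splitG f z = a z * splitG g z := by
    intro z
    rw [splitG_apply, splitG_apply, hfg]
    apply Complex.ext <;> simp
  simp only [stemMatrix, hF, hG, map_mul, ha]
  simp [Matrix.smul_of]

theorem symmetrization_of_forall_eq_mul {f g : ℍ[ℝ] → ℍ[ℝ]} {a : ℂ → ℂ}
    (ha : ∀ z, conj (a (conj z)) = a z)
    (hfg : ∀ z : ℂ, f (z : ℍ[ℝ]) = ((a z : ℂ) : ℍ[ℝ]) * g (z : ℍ[ℝ])) (z : ℂ) :
    symmetrization f z = a z ^ 2 * symmetrization g z := by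
  rw [symmetrization, stemMatrix_of_forall_eq_mul ha hfg, Matrix.det_smul, Fintype.card_fin,
    symmetrization]

theorem norm_sq_splitF_add_norm_sq_splitG (f : ℍ[ℝ] → ℍ[ℝ]) (z : ℂ) :
    ‖splitF f z‖ ^ 2 + ‖splitG f z‖ ^ 2 = ‖f (z : ℍ[ℝ])‖ ^ 2 := by
  rw [Complex.sq_norm, Complex.sq_norm, sq ‖f _‖, ← Quaternion.normSq_eq_norm_mul_self,
    Quaternion.normSq_def', splitF_apply, splitG_apply, Complex.normSq_mk, Complex.normSq_mk]
  ring

theorem norm_symmetrization_le (f : ℍ[ℝ] → ℍ[ℝ]) (z : ℂ) :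
    ‖symmetrization f z‖ ≤ ‖f (z : ℍ[ℝ])‖ * ‖f ((conj z : ℂ) : ℍ[ℝ])‖ := by
  have h1 := norm_sq_splitF_add_norm_sq_splitG f z
  have h2 := norm_sq_splitF_add_norm_sq_splitG f (conj z)
  have h3 : ‖symmetrization f z‖ ≤ ‖splitF f z‖ * ‖splitF f (conj z)‖ +
      ‖splitG f z‖ * ‖splitG f (conj z)‖ := by
    rw [symmetrization_apply]
    refine (norm_add_le _ _).trans (le_of_eq ?_)
    simp
  refine h3.trans (abs_le_of_sq_le_sq' ?_ (by positivity)).2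
  rw [mul_pow, ← h1, ← h2]
  nlinarith [sq_nonneg (‖splitF f z‖ * ‖splitG f (conj z)‖ - ‖splitG f z‖ * ‖splitF f (conj z)‖)]

theorem IsEntireSliceRegular.exists_symmetrization_ne_zero {f : ℍ[ℝ] → ℍ[ℝ]}
    (hf : IsEntireSliceRegular f) (hf0 : ∃ q, f q ≠ 0) : ∃ c, symmetrization f c ≠ 0 := by
  by_contra! h
  -- On the real axis the symmetrization is `|f|²`.
  have hreal : ∀ x : ℝ, f (x : ℍ[ℝ]) = 0 := by
    intro x
    have h1 := h x
    have h2 := norm_sq_splitF_add_norm_sq_splitG f x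
    rw [symmetrization_apply, Complex.conj_ofReal, Complex.mul_conj, Complex.mul_conj,
      Complex.normSq_eq_norm_sq, Complex.normSq_eq_norm_sq, ← Complex.ofReal_add, h2] at h1
    have h3 : ‖f ((x : ℂ) : ℍ[ℝ])‖ ^ 2 = 0 := by exact_mod_cast h1
    simpa using h3
  have hF : splitF f = fun _ => 0 := eq_of_eq_ofReal hf.differentiable_splitF
    (differentiable_const 0) fun x => by
      rw [splitF_apply, Quaternion.coeComplex_coe, hreal]; rfl
  have hG : splitG f = fun _ => 0 := eq_of_eq_ofReal hf.differentiable_splitG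
    (differentiable_const 0) fun x => by
      rw [splitG_apply, Quaternion.coeComplex_coe, hreal]; rfl
  have hz : ∀ z : ℂ, f (z : ℍ[ℝ]) = 0 := by
    intro z
    have h2 := norm_sq_splitF_add_norm_sq_splitG f z
    rw [hF, hG] at h2
    simpa using h2.symm
  obtain ⟨q, hq⟩ := hf0
  by_cases hqi : q.im = 0
  · refine hq ?_
    rw [← Quaternion.re_add_im q, hqi, add_zero]
    exact hreal q.re
  · have hI : (‖q.im‖⁻¹ • q.im) ∈ imaginaryUnits := by
      refine ⟨by simp, ?_⟩
      rw [norm_smul, norm_inv, norm_norm, inv_mul_cancel₀ (norm_ne_zero_iff.mpr hqi)]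
    have h1 := hf.representation hI ⟨q.re, ‖q.im‖⟩
    rw [hz, hz, mul_zero, mul_zero, add_zero, smul_zero, Quaternion.mul_coe_eq_smul, smul_smul,
      mul_inv_cancel₀ (norm_ne_zero_iff.mpr hqi), one_smul, Quaternion.re_add_im] at h1
    exact hq h1

/-! ### Quaternions as complex matrices -/

/-- The complex matrix of a quaternion. -/
def quaternionMatrix (p : ℍ[ℝ]) : Matrix (Fin 2) (Fin 2) ℂ :=
  !![⟨p.re, p.imI⟩, ⟨p.imJ, p.imK⟩; -conj ⟨p.imJ, p.imK⟩, conj ⟨p.re, p.imI⟩]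

theorem det_quaternionMatrix (p : ℍ[ℝ]) :
    (quaternionMatrix p).det = ((Quaternion.normSq p : ℝ) : ℂ) := by
  rw [quaternionMatrix, Matrix.det_fin_two_of, Quaternion.normSq_def']
  apply Complex.ext <;> simp [sq] <;> ring

theorem quaternionMatrix_sub (p q : ℍ[ℝ]) :
    quaternionMatrix (p - q) = quaternionMatrix p - quaternionMatrix q := by
  ext i j
  fin_cases i <;> fin_cases j <;> apply Complex.ext <;> simp [quaternionMatrix] <;> ring

/-- The stem matrix of `q ↦ q - p` at `z`. -/
def linearMatrix (z : ℂ) (p : ℍ[ℝ]) : Matrix (Fin 2) (Fin 2) ℂ :=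
  z • (1 : Matrix (Fin 2) (Fin 2) ℂ) - quaternionMatrix p

theorem stemMatrix_sub_const (p : ℍ[ℝ]) (z : ℂ) :
    stemMatrix (fun q => q - p) z = linearMatrix z p := by
  ext i j
  fin_cases i <;> fin_cases j <;> apply Complex.ext <;>
    simp [linearMatrix, quaternionMatrix, stemMatrix, splitF_apply, splitG_apply]
  ring

theorem norm_im_sq (p : ℍ[ℝ]) : ‖p.im‖ ^ 2 = p.imI ^ 2 + p.imJ ^ 2 + p.imK ^ 2 := by
  rw [sq, ← Quaternion.normSq_eq_norm_mul_self, Quaternion.normSq_def']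
  simp

theorem det_linearMatrix (z : ℂ) (p : ℍ[ℝ]) :
    (linearMatrix z p).det = (z - p.re) ^ 2 + ((‖p.im‖ ^ 2 : ℝ) : ℂ) := by
  rw [linearMatrix, quaternionMatrix, Matrix.det_fin_two, norm_im_sq]
  apply Complex.ext <;> simp [sq] <;> ring

theorem linearMatrix_mul_star (z : ℂ) (p : ℍ[ℝ]) :
    linearMatrix z p * linearMatrix z (star p) = (linearMatrix z p).det • 1 := by
  rw [det_linearMatrix, norm_im_sq, linearMatrix, linearMatrix, quaternionMatrix, quaternionMatrix]
  ext i j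
  fin_cases i <;> fin_cases j <;> apply Complex.ext <;>
    simp [Matrix.mul_apply, Fin.sum_univ_two, sq] <;> ring

theorem det_linearMatrix_star (z : ℂ) (p : ℍ[ℝ]) :
    (linearMatrix z (star p)).det = (linearMatrix z p).det := by
  rw [det_linearMatrix, det_linearMatrix]; simp

theorem isUnit_quaternionMatrix {p : ℍ[ℝ]} (hp : p ≠ 0) : IsUnit (quaternionMatrix p) := by
  rw [Matrix.isUnit_iff_isUnit_det, det_quaternionMatrix, isUnit_iff_ne_zero]
  exact_mod_cast Quaternion.normSq_ne_zero.mpr hp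

/-- Distinct quaternions differ by an invertible one, so the zero divisors `z - p` and `z - p'` have
no common left annihilator. -/
theorem eq_zero_of_mul_linearMatrix {z : ℂ} {p p' : ℍ[ℝ]} (hp : p ≠ p')
    {Y : Matrix (Fin 2) (Fin 2) ℂ} (h : Y * linearMatrix z p = 0)
    (h' : Y * linearMatrix z p' = 0) : Y = 0 := by
  have h1 : Y * quaternionMatrix (p - p') = 0 := by
    have h2 : quaternionMatrix (p - p') = linearMatrix z p' - linearMatrix z p := by
      rw [quaternionMatrix_sub, linearMatrix, linearMatrix]; abel
    rw [h2, mul_sub, h, h', sub_zero]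
  exact (isUnit_quaternionMatrix (sub_ne_zero.mpr hp)).mul_left_eq_zero.mp h1

theorem eq_zero_of_linearMatrix_mul {z : ℂ} {p p' : ℍ[ℝ]} (hp : p ≠ p')
    {Y : Matrix (Fin 2) (Fin 2) ℂ} (h : linearMatrix z p * Y = 0)
    (h' : linearMatrix z p' * Y = 0) : Y = 0 := by
  have h1 : quaternionMatrix (p - p') * Y = 0 := by
    have h2 : quaternionMatrix (p - p') = linearMatrix z p' - linearMatrix z p := by
      rw [quaternionMatrix_sub, linearMatrix, linearMatrix]; abel
    rw [h2, sub_mul, h, h', sub_zero]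
  exact (isUnit_quaternionMatrix (sub_ne_zero.mpr hp)).mul_right_eq_zero.mp h1

/-! ### Spheres and products of linear factors -/

/-- The point `x + i y`, `y ≥ 0`, in which the sphere of `q` meets the closed upper half plane of
`ℂ_i`. -/
def spherePoint (q : ℍ[ℝ]) : ℂ := ⟨q.re, ‖q.im‖⟩

theorem mem_axialSphere_iff {p q : ℍ[ℝ]} : p ∈ axialSphere q ↔ spherePoint p = spherePoint q := by
  rw [Complex.ext_iff]; rfl

theorem mem_axialSphere_self (q : ℍ[ℝ]) : q ∈ axialSphere q := ⟨rfl, rfl⟩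

theorem star_mem_axialSphere {p q : ℍ[ℝ]} (h : p ∈ axialSphere q) : star p ∈ axialSphere q := by
  refine ⟨by simpa using h.1, ?_⟩
  rw [← h.2]; simp

theorem norm_spherePoint (q : ℍ[ℝ]) : ‖spherePoint q‖ = ‖q‖ := by
  rw [← sq_eq_sq₀ (norm_nonneg _) (norm_nonneg _), Complex.sq_norm, spherePoint, Complex.normSq_mk,
    ← sq ‖q.im‖, norm_im_sq, sq ‖q‖, ← Quaternion.normSq_eq_norm_mul_self,
    Quaternion.normSq_def']
  ring

theorem det_linearMatrix_spherePoint (q : ℍ[ℝ]) : (linearMatrix (spherePoint q) q).det = 0 := by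
  rw [det_linearMatrix]
  apply Complex.ext <;> simp [spherePoint, sq]

theorem det_linearMatrix_eq_mul (z : ℂ) (q : ℍ[ℝ]) : (linearMatrix z q).det =
    (z - spherePoint q) * (z - conj (spherePoint q)) := by
  rw [det_linearMatrix]
  apply Complex.ext <;> simp [spherePoint, sq] <;> ring

theorem linearMatrix_ne_zero {z : ℂ} (hz : z.im ≠ 0) (p : ℍ[ℝ]) : linearMatrix z p ≠ 0 := by
  intro h
  have h1 := congrArg Complex.im (congrFun (congrFun h 0) 0)
  have h2 := congrArg Complex.im (congrFun (congrFun h 1) 1)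
  simp [linearMatrix, quaternionMatrix] at h1 h2
  exact hz (by linarith)

theorem stemMatrix_starLinearFactors_cons (p : ℍ[ℝ]) (l : List ℍ[ℝ]) (g : ℍ[ℝ] → ℍ[ℝ]) (z : ℂ) :
    stemMatrix (starLinearFactors (p :: l) g) z =
      linearMatrix z p * stemMatrix (starLinearFactors l g) z := by
  rw [← stemMatrix_sub_const, ← stemMatrix_starProduct]; rfl

/-- Left cancellation down to the first factor: when no two consecutive points are conjugate, a
matrix annihilating the product from the left annihilates its first factor. -/
theorem mul_linearMatrix_eq_zero_of_isChain {q : ℍ[ℝ]} {g : ℍ[ℝ] → ℍ[ℝ]}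
    (hg : symmetrization g (spherePoint q) ≠ 0) (l : List ℍ[ℝ]) :
    ∀ p, (∀ p' ∈ p :: l, p' ∈ axialSphere q) → (p :: l).IsChain (fun a b => b ≠ star a) →
    ∀ Y : Matrix (Fin 2) (Fin 2) ℂ,
      Y * stemMatrix (starLinearFactors (p :: l) g) (spherePoint q) = 0 →
      Y * linearMatrix (spherePoint q) p = 0 := by
  induction l with
  | nil =>
    intro p _ _ Y hY
    rw [stemMatrix_starLinearFactors_cons, ← mul_assoc] at hY
    refine IsUnit.mul_left_eq_zero ?_ |>.mp hY
    rw [Matrix.isUnit_iff_isUnit_det]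
    exact isUnit_iff_ne_zero.mpr hg
  | cons p₂ l ih =>
    intro p hl hc Y hY
    rw [List.isChain_cons_cons] at hc
    rw [stemMatrix_starLinearFactors_cons, ← mul_assoc] at hY
    have h1 := ih p₂ (fun p' hp' => hl p' (List.mem_cons_of_mem _ hp')) hc.2 _ hY
    refine eq_zero_of_mul_linearMatrix hc.1 h1 ?_
    have hp := mem_axialSphere_iff.mp (hl p List.mem_cons_self)
    rw [mul_assoc, linearMatrix_mul_star, ← hp, det_linearMatrix_spherePoint, zero_smul, mul_zero]

theorem stemMatrix_starLinearFactors_ne_zero {q : ℍ[ℝ]} (hq : q.im ≠ 0) {g : ℍ[ℝ] → ℍ[ℝ]}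
    (hg : symmetrization g (spherePoint q) ≠ 0) (l : List ℍ[ℝ]) (p : ℍ[ℝ])
    (hl : ∀ p' ∈ p :: l, p' ∈ axialSphere q) (hc : (p :: l).IsChain (fun a b => b ≠ star a)) :
    stemMatrix (starLinearFactors (p :: l) g) (spherePoint q) ≠ 0 := by
  intro h
  have h1 := mul_linearMatrix_eq_zero_of_isChain hg l p hl hc 1 (by rw [h, mul_zero])
  rw [one_mul] at h1
  exact linearMatrix_ne_zero (norm_ne_zero_iff.mpr hq) p h1

theorem symmetrization_starLinearFactors {q : ℍ[ℝ]} (g : ℍ[ℝ] → ℍ[ℝ]) (z : ℂ) (l : List ℍ[ℝ])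
    (hl : ∀ p ∈ l, p ∈ axialSphere q) :
    symmetrization (starLinearFactors l g) z =
      (linearMatrix z q).det ^ l.length * symmetrization g z := by
  induction l with
  | nil => simp [starLinearFactors]
  | cons p l ih =>
    have hp := mem_axialSphere_iff.mp (hl p List.mem_cons_self)
    rw [symmetrization, stemMatrix_starLinearFactors_cons, Matrix.det_mul, ← symmetrization,
      ih fun p' hp' => hl p' (List.mem_cons_of_mem _ hp'), det_linearMatrix_eq_mul z p, hp,
      ← det_linearMatrix_eq_mul, List.length_cons, pow_succ]
    ring

theorem IsEntireSliceRegular.continuous_stemMatrix_starLinearFactors {g : ℍ[ℝ] → ℍ[ℝ]}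
    (hg : IsEntireSliceRegular g) (l : List ℍ[ℝ]) :
    Continuous (stemMatrix (starLinearFactors l g)) := by
  induction l with
  | nil => exact hg.continuous_stemMatrix
  | cons p l ih =>
    have h : stemMatrix (starLinearFactors (p :: l) g) = fun z =>
        linearMatrix z p * stemMatrix (starLinearFactors l g) z :=
      funext (stemMatrix_starLinearFactors_cons p l g)
    rw [h]
    refine Continuous.mul ?_ ih
    exact (continuous_id.smul continuous_const).sub continuous_const

/-- On the sphere of `q` a slice regular function is affine in the imaginary unit; when the
symmetrization vanishes there, solving this affine equation gives a unit, hence a zero. -/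
theorem IsEntireSliceRegular.symmetrization_ne_zero {g : ℍ[ℝ] → ℍ[ℝ]}
    (hg : IsEntireSliceRegular g) {q : ℍ[ℝ]} (hz : ∀ p ∈ axialSphere q, g p ≠ 0) :
    symmetrization g (spherePoint q) ≠ 0 := by
  intro h0
  set z := spherePoint q with hzdef
  have hmem : ∀ I ∈ imaginaryUnits, (z.re : ℍ[ℝ]) + I * (z.im : ℍ[ℝ]) ∈ axialSphere q := by
    intro I hI
    have him : ((z.re : ℍ[ℝ]) + I * (z.im : ℍ[ℝ])).im = z.im • I := by
      have := hI.1
      ext <;> simp [Quaternion.mul_coe_eq_smul, this]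
    refine ⟨by simp [Quaternion.mul_coe_eq_smul, hI.1, hzdef, spherePoint], ?_⟩
    rw [him, norm_smul, hI.2, mul_one]
    simp [hzdef, spherePoint]
  set u := g (z : ℍ[ℝ]) with hu
  set w := g ((conj z : ℂ) : ℍ[ℝ]) with hw
  rw [symmetrization_apply, splitF_apply, splitG_apply, splitF_apply, splitG_apply, ← hu, ← hw]
    at h0
  have hre := congrArg Complex.re h0
  have him := congrArg Complex.im h0
  simp at hre him
  have hi2 := mul_self_of_mem_imaginaryUnits unitI_mem_imaginaryUnits
  by_cases huw : u = w
  · refine hz _ (hmem _ unitI_mem_imaginaryUnits) ?_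
    rw [ofReal_add_unitI_mul, ← hu, ← Quaternion.normSq_eq_zero, Quaternion.normSq_def']
    rw [← huw] at hre
    linarith
  · have hd : u - w ≠ 0 := sub_ne_zero.mpr huw
    have hn : Quaternion.normSq (u + w) = Quaternion.normSq (u - w) := by
      rw [Quaternion.normSq_def', Quaternion.normSq_def']
      simp
      linarith
    set I := -((u + w) * (u - w)⁻¹ * unitI) with hIdef
    have hI : I ∈ imaginaryUnits := by
      constructor
      · rw [hIdef, Quaternion.inv_def, mul_smul_comm, smul_mul_assoc, Quaternion.re_neg,
          Quaternion.re_smul, smul_eq_mul, neg_eq_zero]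
        refine mul_eq_zero_of_right _ ?_
        simp
        linarith
      · rw [hIdef, norm_neg, norm_mul, unitI_mem_imaginaryUnits.2, mul_one, norm_mul, norm_inv]
        have h1 : ‖u + w‖ = ‖u - w‖ := by
          rw [Quaternion.normSq_eq_norm_mul_self, Quaternion.normSq_eq_norm_mul_self, ← sq, ← sq]
            at hn
          exact (sq_eq_sq₀ (norm_nonneg _) (norm_nonneg _)).mp hn
        rw [h1, mul_inv_cancel₀ (norm_ne_zero_iff.mpr hd)]
    have hIi : I * unitI = (u + w) * (u - w)⁻¹ := by
      rw [hIdef, neg_mul, mul_assoc, hi2, mul_neg_one, neg_neg]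
    refine hz _ (hmem I hI) ?_
    rw [hg.representation hI, ← hu, ← hw, hIi]
    have h2 : (1 - (u + w) * (u - w)⁻¹) * u + (1 + (u + w) * (u - w)⁻¹) * w =
        (u + w) - (u + w) * ((u - w)⁻¹ * (u - w)) := by noncomm_ring
    rw [h2, inv_mul_cancel₀ hd, mul_one, sub_self, smul_zero]

/-! ### Multiplicities and orders of vanishing -/

theorem natCast_le_analyticOrderAt_of_forall_eq {h k : ℂ → ℂ} (hh : Differentiable ℂ h)
    (hk : Differentiable ℂ k) {z₀ : ℂ} {n : ℕ} (heq : ∀ z, h z = (z - z₀) ^ n * k z) :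
    (n : ℕ∞) ≤ analyticOrderAt h z₀ :=
  (natCast_le_analyticOrderAt (hh.analyticAt z₀)).mpr
    ⟨k, hk.analyticAt z₀, Eventually.of_forall heq⟩

theorem realMultiplicity_le {f : ℍ[ℝ] → ℍ[ℝ]} (hf : IsEntireSliceRegular f) (x : ℝ) :
    realMultiplicity f x ≤ analyticOrderAt (symmetrization f) x := by
  refine sSup_le ?_
  rintro _ ⟨r, ⟨g, hg, -, hfg⟩, rfl⟩
  refine natCast_le_analyticOrderAt_of_forall_eq hf.differentiable_symmetrization
    (k := fun z => (z - x) ^ r * symmetrization g z)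
    (by have := hg.differentiable_symmetrization; fun_prop) fun z => ?_
  rw [symmetrization_of_forall_eq_mul (f := f) (g := g) (a := fun z => (z - x) ^ r) (by simp)]
  · ring
  · intro z
    rw [hfg]
    congr 1
    change _ = Quaternion.ofComplex ((z - x) ^ r)
    rw [map_pow, map_sub]
    rfl

theorem spherePolynomial_pow_coeComplex (q : ℍ[ℝ]) (m : ℕ) (z : ℂ) :
    spherePolynomial q (z : ℍ[ℝ]) ^ m = (((linearMatrix z q).det ^ m : ℂ) : ℍ[ℝ]) := by
  rw [det_linearMatrix]
  change _ = Quaternion.ofComplex _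
  rw [map_pow, map_add, map_pow, map_sub]
  rfl

theorem conj_det_linearMatrix_conj (q : ℍ[ℝ]) (m : ℕ) (z : ℂ) :
    conj ((linearMatrix (conj z) q).det ^ m) = (linearMatrix z q).det ^ m := by
  simp [det_linearMatrix]

theorem symmetrization_of_forall_eq_spherePolynomial_pow_mul {f g : ℍ[ℝ] → ℍ[ℝ]} {q : ℍ[ℝ]}
    {m : ℕ} (hfg : ∀ p, f p = spherePolynomial q p ^ m * g p) (z : ℂ) :
    symmetrization f z = ((linearMatrix z q).det ^ m) ^ 2 * symmetrization g z :=
  symmetrization_of_forall_eq_mul (a := fun z => (linearMatrix z q).det ^ m)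
    (conj_det_linearMatrix_conj q m)
    (fun z => by rw [hfg, spherePolynomial_pow_coeComplex]) z

theorem sphericalMultiplicity_le {f : ℍ[ℝ] → ℍ[ℝ]} (hf : IsEntireSliceRegular f) (q : ℍ[ℝ]) :
    sphericalMultiplicity f q ≤ analyticOrderAt (symmetrization f) (spherePoint q) := by
  refine sSup_le ?_
  rintro _ ⟨m, ⟨g, hg, -, hfg⟩, rfl⟩
  refine natCast_le_analyticOrderAt_of_forall_eq hf.differentiable_symmetrization
    (k := fun z => (z - spherePoint q) ^ m * ((z - conj (spherePoint q)) ^ m) ^ 2 *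
      symmetrization g z)
    (by have := hg.differentiable_symmetrization; fun_prop) fun z => ?_
  rw [symmetrization_of_forall_eq_spherePolynomial_pow_mul hfg, det_linearMatrix_eq_mul,
    mul_pow]
  ring

theorem isolatedMultiplicity_le {f : ℍ[ℝ] → ℍ[ℝ]} (hf : IsEntireSliceRegular f) (q : ℍ[ℝ]) :
    isolatedMultiplicity f q ≤ analyticOrderAt (symmetrization f) (spherePoint q) := by
  refine sSup_le ?_
  rintro _ ⟨r, ⟨l, rfl, hl, -, m, g, hg, -, hfg⟩, rfl⟩
  have hl' : ∀ p ∈ q :: l, p ∈ axialSphere q := by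
    simpa using ⟨mem_axialSphere_self q, hl⟩
  refine natCast_le_analyticOrderAt_of_forall_eq hf.differentiable_symmetrization
    (k := fun z => ((z - spherePoint q) ^ m * (z - conj (spherePoint q)) ^ m) ^ 2 *
      (z - conj (spherePoint q)) ^ (q :: l).length * symmetrization g z)
    (by have := hg.differentiable_symmetrization; fun_prop) fun z => ?_
  rw [symmetrization_of_forall_eq_spherePolynomial_pow_mul hfg,
    symmetrization_starLinearFactors g z _ hl', det_linearMatrix_eq_mul]
  simp only [mul_pow]
  ring

/-! ### Uniqueness of the isolated zero on a sphere -/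

/-- Both sides may be divided by the common power `a ^ m`, also at a zero `z₀` of `a`, by
continuity. -/
theorem eq_pow_smul_of_pow_smul_eq {E : Type*} [AddCommGroup E] [Module ℂ E] [TopologicalSpace E]
    [T2Space E] [ContinuousSMul ℂ E] {a : ℂ → ℂ} {V W : ℂ → E} (ha : Continuous a)
    (hV : Continuous V) (hW : Continuous W) {z₀ : ℂ} (ha0 : ∀ᶠ z in 𝓝[≠] z₀, a z ≠ 0)
    {m n : ℕ} (hmn : m ≤ n) (h : ∀ z, a z ^ m • V z = a z ^ n • W z) :
    V z₀ = a z₀ ^ (n - m) • W z₀ := by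
  have h1 : Tendsto V (𝓝[≠] z₀) (𝓝 (V z₀)) := (hV.tendsto z₀).mono_left nhdsWithin_le_nhds
  have h2 : Tendsto (fun z => a z ^ (n - m) • W z) (𝓝[≠] z₀) (𝓝 (a z₀ ^ (n - m) • W z₀)) :=
    (((ha.pow (n - m)).smul hW).tendsto z₀).mono_left nhdsWithin_le_nhds
  refine tendsto_nhds_unique h1 (h2.congr' ?_)
  filter_upwards [ha0] with z hz
  have h3 := h z
  rw [← Nat.add_sub_cancel' hmn, pow_add, mul_smul] at h3
  simpa using (smul_right_injective E (pow_ne_zero m hz) h3).symm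

theorem eventually_det_linearMatrix_ne_zero {q : ℍ[ℝ]} (hq : q.im ≠ 0) :
    ∀ᶠ z in 𝓝[≠] (spherePoint q), (linearMatrix z q).det ≠ 0 := by
  have h1 : spherePoint q ≠ conj (spherePoint q) := by
    intro h
    have h2 := congrArg Complex.im h
    have h3 : 0 < ‖q.im‖ := norm_pos_iff.mpr hq
    simp only [spherePoint, Complex.conj_im] at h2
    linarith
  filter_upwards [self_mem_nhdsWithin,
    nhdsWithin_le_nhds (isOpen_ne.mem_nhds h1)] with z hz hz'
  rw [det_linearMatrix_eq_mul]
  exact mul_ne_zero (sub_ne_zero.mpr hz) (sub_ne_zero.mpr hz')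

/-- After removal of a power of the sphere polynomial, `f` leaves a factor with stem matrix `W`
which does not vanish identically on the sphere of `q` but vanishes at `q`: annihilation of `W`
by the matrix of `z - star q` expresses that `W` has the left factor `z - q`. -/
theorem exists_stemMatrix_of_isolatedMultiplicity_ne_zero {f : ℍ[ℝ] → ℍ[ℝ]} {q : ℍ[ℝ]}
    (hq : q.im ≠ 0) (hf : isolatedMultiplicity f q ≠ 0) :
    ∃ (m : ℕ) (W : ℂ → Matrix (Fin 2) (Fin 2) ℂ), Continuous W ∧ W (spherePoint q) ≠ 0 ∧
      linearMatrix (spherePoint q) (star q) * W (spherePoint q) = 0 ∧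
      ∀ z, stemMatrix f z = (linearMatrix z q).det ^ m • W z := by
  obtain ⟨r, l, -, hl, hc, m, g, hg, hgz, hfg⟩ : {r | ∃ l : List ℍ[ℝ], (q :: l).length = r ∧
      (∀ p ∈ l, p ∈ axialSphere q) ∧ (q :: l).IsChain (fun a b => b ≠ star a) ∧
      ∃ (m : ℕ) (g : ℍ[ℝ] → ℍ[ℝ]), IsEntireSliceRegular g ∧ (∀ p ∈ axialSphere q, g p ≠ 0) ∧
        ∀ p, f p = spherePolynomial q p ^ m * starLinearFactors (q :: l) g p}.Nonempty := by
    by_contra! hempty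
    refine hf ?_
    rw [isolatedMultiplicity, hempty, Set.image_empty, sSup_empty]
    rfl
  have hl' : ∀ p ∈ q :: l, p ∈ axialSphere q := by
    simpa using ⟨mem_axialSphere_self q, hl⟩
  refine ⟨m, stemMatrix (starLinearFactors (q :: l) g),
    hg.continuous_stemMatrix_starLinearFactors _,
    stemMatrix_starLinearFactors_ne_zero hq (hg.symmetrization_ne_zero hgz) l q hl' hc, ?_,
    stemMatrix_of_forall_eq_mul (a := fun z => (linearMatrix z q).det ^ m)
      (conj_det_linearMatrix_conj q m)
      fun z => by rw [hfg, spherePolynomial_pow_coeComplex]⟩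
  have h1 := linearMatrix_mul_star (spherePoint q) (star q)
  rw [star_star, det_linearMatrix_star, det_linearMatrix_spherePoint, zero_smul] at h1
  rw [stemMatrix_starLinearFactors_cons, ← mul_assoc, h1, zero_mul]

/-- Each sphere carries at most one point of positive isolated multiplicity. -/
theorem eq_of_isolatedMultiplicity_ne_zero {f : ℍ[ℝ] → ℍ[ℝ]} {p q : ℍ[ℝ]} (hq : q.im ≠ 0)
    (hpq : p ∈ axialSphere q) (hfp : isolatedMultiplicity f p ≠ 0)
    (hfq : isolatedMultiplicity f q ≠ 0) : p = q := by
  have hp : p.im ≠ 0 := by rw [← norm_ne_zero_iff, hpq.2]; exact norm_ne_zero_iff.mpr hq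
  have hsp := mem_axialSphere_iff.mp hpq
  have hdet : ∀ z, (linearMatrix z p).det = (linearMatrix z q).det := by
    intro z
    rw [det_linearMatrix_eq_mul, hsp, ← det_linearMatrix_eq_mul]
  obtain ⟨m, V, hV, hV0, hVp, hfV⟩ := exists_stemMatrix_of_isolatedMultiplicity_ne_zero hp hfp
  obtain ⟨n, W, hW, hW0, hWq, hfW⟩ := exists_stemMatrix_of_isolatedMultiplicity_ne_zero hq hfq
  rw [hsp] at hV0 hVp
  have heq : ∀ z, (linearMatrix z q).det ^ m • V z = (linearMatrix z q).det ^ n • W z := by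
    intro z
    rw [← hfW, hfV, hdet]
  have hne := eventually_det_linearMatrix_ne_zero hq
  have hcont : Continuous fun z => (linearMatrix z q).det := by
    simp only [det_linearMatrix]
    fun_prop
  -- The exponents agree, since neither `V` nor `W` vanishes at the point of the sphere.
  have hmn : m = n := by
    rcases lt_trichotomy m n with hlt | h | hlt
    · have h1 := eq_pow_smul_of_pow_smul_eq hcont hV hW hne hlt.le heq
      rw [det_linearMatrix_spherePoint, zero_pow (by omega), zero_smul] at h1
      exact absurd h1 hV0
    · exact h
    · have h1 := eq_pow_smul_of_pow_smul_eq hcont hW hV hne hlt.le fun z => (heq z).symm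
      rw [det_linearMatrix_spherePoint, zero_pow (by omega), zero_smul] at h1
      exact absurd h1 hW0
  subst hmn
  have hVW := eq_pow_smul_of_pow_smul_eq hcont hV hW hne le_rfl heq
  rw [Nat.sub_self, pow_zero, one_smul] at hVW
  by_contra hne'
  exact hW0 (eq_zero_of_linearMatrix_mul (fun h => hne' (star_injective h)) (hVW ▸ hVp) hWq)

/-! ### Zero sequences -/

/-- The entries of a zero sequence on one sphere are bounded in number by the order of the
symmetrization: at most three points of the sphere are listed. -/
theorem IsZeroSequence.encard_le {ι : Type*} {f : ℍ[ℝ] → ℍ[ℝ]} (hf : IsEntireSliceRegular f)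
    {γ : ι → ℍ[ℝ]} (hγ : IsZeroSequence f γ) (z : ℂ) :
    {i | spherePoint (γ i) = z}.encard ≤ 6 * analyticOrderAt (symmetrization f) z := by
  rcases Set.eq_empty_or_nonempty {i | spherePoint (γ i) = z} with hE | ⟨i₀, hi₀⟩
  · simp [hE]
  set q₀ := γ i₀ with hq₀def
  have hset : {i | spherePoint (γ i) = z} = {i | γ i ∈ axialSphere q₀} := by
    apply Set.ext
    intro i
    rw [Set.mem_ofPred_eq, Set.mem_ofPred_eq, mem_axialSphere_iff, hi₀]
  have hone : ∀ n : ℕ∞, n ≤ 6 * n := fun n => le_mul_of_one_le_left' (by norm_num)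
  by_cases hq₀ : q₀.im = 0
  · have hz : z = (q₀.re : ℂ) := by
      rw [← hi₀]
      apply Complex.ext <;> simp [spherePoint, ← hq₀def, hq₀]
    have hsub : {i | γ i ∈ axialSphere q₀} ⊆ {i | γ i = (q₀.re : ℍ[ℝ])} := by
      rintro i ⟨h1, h2⟩
      rw [hq₀, norm_zero, norm_eq_zero] at h2
      rw [Set.mem_ofPred_eq, ← Quaternion.re_add_im (γ i), h2, add_zero, h1]
    rw [hset]
    refine (Set.encard_le_encard hsub).trans ?_
    rw [hγ.real, hz]
    exact (realMultiplicity_le hf _).trans (hone _)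
  · obtain ⟨β, hβ, hβq⟩ := hγ.nonreal q₀ hq₀
    set N := analyticOrderAt (symmetrization f) z with hN
    have hle : ∀ q ∈ axialSphere q₀, {i | γ i = q}.encard ≤ 2 * N := by
      intro q hq
      rw [hβq q hq, two_mul]
      refine add_le_add ?_ ?_
      · split_ifs
        · rw [hN, ← hi₀]; exact sphericalMultiplicity_le hf q₀
        · exact zero_le
      · rw [hN, ← hi₀, ← mem_axialSphere_iff.mp hq]; exact isolatedMultiplicity_le hf q
    obtain ⟨q₁, hq₁, hq₁'⟩ : ∃ q₁ ∈ axialSphere q₀, ∀ q ∈ axialSphere q₀, q ≠ q₁ →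
        isolatedMultiplicity f q = 0 := by
      by_cases h : ∃ q₁ ∈ axialSphere q₀, isolatedMultiplicity f q₁ ≠ 0
      · obtain ⟨q₁, hq₁, h1⟩ := h
        refine ⟨q₁, hq₁, fun q hq hne => ?_⟩
        by_contra h2
        have hq₁im : q₁.im ≠ 0 := by
          rw [← norm_ne_zero_iff, hq₁.2]; exact norm_ne_zero_iff.mpr hq₀
        refine hne (eq_of_isolatedMultiplicity_ne_zero hq₁im ?_ h2 h1)
        rw [mem_axialSphere_iff, mem_axialSphere_iff.mp hq, mem_axialSphere_iff.mp hq₁]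
      · push Not at h
        exact ⟨β, hβ, fun q hq _ => h q hq⟩
    -- Any other point of the sphere has listed multiplicity `0`.
    have hsub : {i | γ i ∈ axialSphere q₀} ⊆
        ({i | γ i = β} ∪ {i | γ i = star β}) ∪ {i | γ i = q₁} := by
      intro i hi
      by_contra hcon
      simp only [Set.mem_union, Set.mem_ofPred_eq, not_or] at hcon
      have h1 := hβq (γ i) hi
      rw [if_neg (by tauto), hq₁' _ hi hcon.2, add_zero, Set.encard_eq_zero] at h1
      have h2 : i ∈ {j | γ j = γ i} := rfl
      rw [h1] at h2
      exact h2
    rw [hset]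
    calc _ ≤ _ := Set.encard_le_encard hsub
      _ ≤ ({i | γ i = β}.encard + {i | γ i = star β}.encard) + {i | γ i = q₁}.encard :=
        (Set.encard_union_le _ _).trans (by gcongr; exact Set.encard_union_le _ _)
      _ ≤ (2 * N + 2 * N) + 2 * N :=
        add_le_add (add_le_add (hle _ hβ) (hle _ (star_mem_axialSphere hβ))) (hle _ hq₁)
      _ = 6 * N := by ring

/-! ### Growth of the symmetrization and the convergence exponent -/

theorem norm_le_maxModulus {f : ℍ[ℝ] → ℍ[ℝ]} (hf : Continuous f) (q : ℍ[ℝ]) :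
    ‖f q‖ ≤ maxModulus f ‖q‖ :=
  le_csSup ((isCompact_sphere (0 : ℍ[ℝ]) ‖q‖).image hf.norm).bddAbove
    ⟨q, by simp, rfl⟩

theorem norm_coeComplex (z : ℂ) : ‖(z : ℍ[ℝ])‖ = ‖z‖ := by
  rw [← sq_eq_sq₀ (norm_nonneg _) (norm_nonneg _), Complex.sq_norm, sq,
    ← Quaternion.normSq_eq_norm_mul_self, Quaternion.normSq_def', Complex.normSq_apply]
  simp [sq]

theorem norm_symmetrization_le_maxModulus {f : ℍ[ℝ] → ℍ[ℝ]} (hf : Continuous f) (z : ℂ) :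
    ‖symmetrization f z‖ ≤ maxModulus f ‖z‖ ^ 2 := by
  have h1 := norm_le_maxModulus hf (z : ℍ[ℝ])
  have h2 := norm_le_maxModulus hf ((conj z : ℂ) : ℍ[ℝ])
  rw [norm_coeComplex] at h1 h2
  rw [Complex.norm_conj] at h2
  rw [sq]
  exact (norm_symmetrization_le f z).trans
    (mul_le_mul h1 h2 (norm_nonneg _) ((norm_nonneg _).trans h1))

/-- The counting function of the zeros is `O(r ^ k)` when `M_f(r) < exp (r ^ k)` for large `r`. -/
theorem IsZeroSequence.exists_card_le {ι : Type*} {f : ℍ[ℝ] → ℍ[ℝ]}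
    (hf : IsEntireSliceRegular f) (hf0 : ∃ q, f q ≠ 0) {γ : ι → ℍ[ℝ]} (hγ : IsZeroSequence f γ)
    {k : ℝ} (hk : 0 < k) (hM : ∀ᶠ r : ℝ in atTop, maxModulus f r < Real.exp (r ^ k)) :
    ∃ C r₀ : ℝ, ∀ r, r₀ ≤ r → ∀ T : Finset ι, (∀ i ∈ T, ‖γ i‖ ≤ r) → (T.card : ℝ) ≤ C * r ^ k := by
  classical
  set h := symmetrization f with hh
  have hd : Differentiable ℂ h := hf.differentiable_symmetrization
  -- Jensen's inequality is centred at a point `c` with `h c ≠ 0`; the origin may be a zero.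
  obtain ⟨c, hc⟩ : ∃ c, h c ≠ 0 := hf.exists_symmetrization_ne_zero hf0
  have htop : ∀ z, analyticOrderAt h z ≠ ⊤ := fun z =>
    AnalyticOnNhd.analyticOrderAt_ne_top_of_isPreconnected (U := Set.univ) (x := c)
      (fun z _ => hd.analyticAt z) isPreconnected_univ (Set.mem_univ _) (Set.mem_univ _) (by
        rw [(hd.analyticAt c).analyticOrderAt_eq_zero.mpr hc]; simp)
  obtain ⟨R, hR⟩ := eventually_atTop.mp hM
  set L := Real.log ‖h c‖ with hL
  refine ⟨6 * ((2 * 5 ^ k + |L|) / Real.log 2), max 1 (max R ‖c‖), fun r hr T hT => ?_⟩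
  have hr1 : 1 ≤ r := (le_max_left _ _).trans hr
  have hrR : R ≤ r := ((le_max_left _ _).trans (le_max_right _ _)).trans hr
  have hrc : ‖c‖ ≤ r := ((le_max_right _ _).trans (le_max_right _ _)).trans hr
  have hr0 : 0 < r := by linarith
  have hc0 := norm_nonneg c
  -- The disc of radius `r` about `0` lies in that of radius `r + |c|` about `c`, and the circle of
  -- twice this radius lies in the annulus `r ≤ |z| ≤ 5 r`.
  set M := Real.exp (2 * (5 * r) ^ k) with hMdef
  have hbound : ∀ z ∈ Metric.sphere c (2 * (r + ‖c‖)), ‖h z‖ ≤ M := by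
    intro z hz
    rw [mem_sphere_iff_norm] at hz
    have h1 : r ≤ ‖z‖ := by have := norm_sub_le z c; linarith
    have h2 : ‖z‖ ≤ 5 * r := by have := norm_sub_norm_le z c; linarith
    have h3 := (norm_nonneg _).trans (norm_le_maxModulus hf.1.continuous (z : ℍ[ℝ]))
    rw [norm_coeComplex] at h3
    calc ‖h z‖ ≤ maxModulus f ‖z‖ ^ 2 := norm_symmetrization_le_maxModulus hf.1.continuous z
      _ ≤ Real.exp (‖z‖ ^ k) ^ 2 := by
        have := (hR ‖z‖ (hrR.trans h1)).le
        gcongr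
      _ = Real.exp (2 * ‖z‖ ^ k) := by rw [← Real.exp_nat_mul]; norm_num
      _ ≤ M := by rw [hMdef]; gcongr
  have hM1 : 1 ≤ M := Real.one_le_exp (by positivity)
  have hjensen := sum_analyticOrderNatAt_le hd hc (r := r + ‖c‖) (by positivity) hM1 hbound
    (T.image fun i => spherePoint (γ i)) (by
      intro z hz
      obtain ⟨i, hi, rfl⟩ := Finset.mem_image.mp hz
      rw [mem_closedBall_iff_norm]
      refine (norm_sub_le _ _).trans ?_
      rw [norm_spherePoint]
      linarith [hT i hi])
  have hcard : (T.card : ℝ) ≤ 6 * ∑ z ∈ T.image fun i => spherePoint (γ i),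
      (analyticOrderNatAt h z : ℝ) := by
    have h1 : T.card ≤ ∑ z ∈ T.image fun i => spherePoint (γ i), 6 * analyticOrderNatAt h z := by
      rw [Finset.card_eq_sum_card_image (fun i => spherePoint (γ i)) T]
      refine Finset.sum_le_sum fun z _ => ?_
      have h2 : ((T.filter fun i => spherePoint (γ i) = z : Finset ι) : Set ι).encard ≤
          6 * analyticOrderAt h z :=
        (Set.encard_le_encard fun i hi => (Finset.mem_filter.mp hi).2).trans (hγ.encard_le hf z)
      rw [Set.encard_coe_eq_coe_finsetCard, ← Nat.cast_analyticOrderNatAt (htop z)] at h2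
      exact_mod_cast h2
    rw [← Finset.mul_sum] at h1
    exact_mod_cast h1
  have hlog2 : 0 < Real.log 2 := Real.log_pos one_lt_two
  have hrk : 1 ≤ r ^ k := Real.one_le_rpow hr1 hk.le
  have hlog : Real.log (M / ‖h c‖) ≤ (2 * 5 ^ k + |L|) * r ^ k := by
    rw [Real.log_div (Real.exp_pos _).ne' (norm_ne_zero_iff.mpr hc), Real.log_exp, ← hL,
      Real.mul_rpow (by norm_num) hr0.le]
    have h1 : -L ≤ |L| * r ^ k :=
      (neg_le_abs L).trans (le_mul_of_one_le_right (abs_nonneg _) hrk)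
    linarith
  calc (T.card : ℝ) ≤ 6 * (Real.log (M / ‖h c‖) / Real.log 2) := by linarith
    _ ≤ 6 * ((2 * 5 ^ k + |L|) * r ^ k / Real.log 2) := by gcongr
    _ = 6 * ((2 * 5 ^ k + |L|) / Real.log 2) * r ^ k := by ring

theorem IsZeroSequence.convergenceExponent_le_order {ι : Type*} {f : ℍ[ℝ] → ℍ[ℝ]}
    (hf : IsEntireSliceRegular f) (hf0 : ∃ q, f q ≠ 0) {γ : ι → ℍ[ℝ]} (hγ : IsZeroSequence f γ) :
    convergenceExponent γ ≤ order f := by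
  refine le_sInf ?_
  rintro _ ⟨k, ⟨hk, hM⟩, rfl⟩
  obtain ⟨C, r₀, hC⟩ := hγ.exists_card_le hf hf0 hk hM
  refine EReal.le_of_forall_lt_iff_le.mp fun s hs => ?_
  have hks : k < s := EReal.coe_lt_coe_iff.mp hs
  exact sInf_le ⟨s, ⟨hk.trans hks,
    (summable_one_div_rpow_of_card_le hk hks hC).subtype _⟩, rfl⟩

end SliceRegular

end

theorem mainTheorem9 (f : Quaternion ℝ → Quaternion ℝ) (hf : SliceRegular.IsEntireSliceRegular f)
    (hf0 : ∃ q, f q ≠ 0) {ι : Type*} (γ : ι → Quaternion ℝ)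
    (hγ : SliceRegular.IsZeroSequence f γ) :
    (SliceRegular.IsIntrinsic f →
      SliceRegular.convergenceExponent γ ≤ SliceRegular.order f) ∧
    (SliceRegular.HasOnlyIsolatedZeros f →
      SliceRegular.convergenceExponent γ ≤ SliceRegular.order f) :=
  ⟨fun _ => hγ.convergenceExponent_le_order hf hf0, fun _ => hγ.convergenceExponent_le_order hf hf0⟩
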